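/- Consider the slow-particle traffic model on the lattice $\mathbb Z$. A configuration is a map $X:\mathbb Z\to\{0,1\}$, where $X(x)=1$ means that there is a particle at $x$. The map $T$ on configurations is defined by $TX(x)=1$ if $X(x)=0$ and $X(x-1)=1$, or if $X(x)=1$ and $X(x+1)=1$; and $TX(x)=0$ otherwise (each particle moves one place forward if that place is empty, and stays put otherwise). For integers $k\le n$ let $m(X_k^n)=\#\{x: k\le x\le n,\ X(x)=1\}$. Let $v(X,x)=1$ if $X(x)=1$ and $X(x+1)=0$, and $v(X,x)=0$ otherwise. The average velocity of $X$ is the limit $$V(X)=\lim_{n\to\infty}\frac{1}{m(X_{-n}^{n-1})}\sum_{x=-n}^{n-1}v(X,x),$$ if it exists. Let $X$ be a configuration with at least one particle which satisfies the regularity assumption with density $\rho$: there is a strictly decreasing function $\varphi$ with $\varphi(N)\to0$ as $N\to\infty$ such that for all $n\in\mathbb Z$ and all integers $N\ge1$ $$\left|\frac{m(X_{n+1}^{n+N})}{N}-\rho\right|\le\varphi(N).$$ Suppose that $\rho\ne\frac12$. Then there is $t_0\in\mathbb N$ such that for every integer $t\ge t_0$ the average velocity $V(T^tX)$ exists and $$V(T^tX)=\min\left(1,\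 \frac1\rho-1\right),$$ where the right-hand side is read as $1$ if $\rho=0$. -/

import Mathlib

open Filter Topology

namespace SlowTraffic

/-- Configurations on the lattice `ℤ`: `X x = true` (the letter 1) means that there is a particle
at `x`, and `X x = false` (the letter 0) means that the position `x` is empty. -/
abbrev Config : Type := ℤ → Bool

/-- One time step of the slow-particle model: all particles simultaneously look at the next
position; a particle moves there if it is empty and stays where it is otherwise. -/
def step (X : Config) : Config := fun x =>
  if X x = false ∧ X (x - 1) = true then true
  else if X x = true ∧ X (x + 1) = true then true
  else false

/-- The local velocity: `1` if there is a free particle at `x`, and `0` otherwise. -/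
def localVelocity (X : Config) (x : ℤ) : ℕ :=
  if X x = true ∧ X (x + 1) = false then 1 else 0

/-- The number of particles of `X` at the positions `k, k + 1, …, n`. -/
noncomputable def numParticles (X : Config) (k n : ℤ) : ℕ :=
  ((Finset.Icc k n).filter (fun x => X x = true)).card

/-- The average velocity of the subconfiguration of `X` on `{k, …, n}`: the sum of the local
velocities at `k, …, n - 1` divided by the number of particles at these positions. -/
noncomputable def subVelocity (X : Config) (k n : ℤ) : ℝ :=
  ((∑ x ∈ Finset.Icc k (n - 1), localVelocity X x : ℕ) : ℝ) / (numParticles X k (n - 1) : ℝ)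

/-- The average velocity of the entire configuration `X` is well defined and equal to `v`. -/
def HasAverageVelocity (X : Config) (v : ℝ) : Prop :=
  Tendsto (fun n : ℕ => subVelocity X (-(n : ℤ)) (n : ℤ)) atTop (𝓝 v)

/-- The regularity assumption with density `ρ`: the frequency of particles in every window of
length `N ≥ 1` is within `φ N` of `ρ`, where the rate function `φ` is one-to-one, monotone and
tends to `0`. Since `φ` bounds an absolute value, monotone means decreasing here. -/
def IsRegular (X : Config) (ρ : ℝ) : Prop :=
  ∃ φ : ℕ → ℝ, StrictAnti φ ∧ Tendsto φ atTop (𝓝 0) ∧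
    ∀ (n : ℤ) (N : ℕ), 1 ≤ N →
      |(numParticles X (n + 1) (n + N) : ℝ) / (N : ℝ) - ρ| ≤ φ N

end SlowTraffic

/-!
Particles are conserved, so the particle count of a window `{k, …, n}` changes in one step by the
inflow `localVelocity X (k - 1)` minus the outflow `localVelocity X n` (`numParticles_step`).

Suppose `step X` has two adjacent particles at `n - 1, n`. Then `X` has two adjacent particles at
`n, n + 1`, and a window of `step X` ending at `n` in which particles outnumber holes by at least
two comes from a strictly longer window of `X` ending at `n + 1` with the same property: if a
particle entered the window from the left during the step, include its old position as well
(`exists_dense_window_step`). Iterating, a pair of adjacent particles at time `t` forces an initial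
window of length at least `t + 2` with density at least `1 / 2`. Regularity with `ρ < 1 / 2` excludes
this for large `t`. From then on every particle is free, and the velocity of every window
containing a particle is exactly `1`.

Holes behave in the same way with left and right exchanged (`exists_sparse_window_step`), so for
`ρ > 1 / 2` there are eventually no two adjacent holes. Then `localVelocity X x = 1` exactly when
`x + 1` is a hole, so the free particles have density `1 - ρ`. The density itself is preserved in
time by the conservation law (`tendsto_density_iterate`), and the velocity is `(1 - ρ) / ρ`.
-/

namespace SlowTraffic

/-! ### Counting particles in windows -/

lemma numParticles_eq_sum (X : Config) (k n : ℤ) :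
    numParticles X k n = ∑ x ∈ Finset.Icc k n, (X x).toNat := by
  rw [numParticles, Finset.card_filter]
  refine Finset.sum_congr rfl fun x _ => ?_
  cases X x <;> rfl

lemma sum_Icc_succ_right (f : ℤ → ℕ) {k n : ℤ} (h : k ≤ n + 1) :
    ∑ x ∈ Finset.Icc k (n + 1), f x = ∑ x ∈ Finset.Icc k n, f x + f (n + 1) := by
  have : Finset.Icc k (n + 1) = insert (n + 1) (Finset.Icc k n) := by
    ext x; simp only [Finset.mem_Icc, Finset.mem_insert]; omega
  rw [this, Finset.sum_insert (by simp), add_comm]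

lemma numParticles_succ_right (X : Config) {k n : ℤ} (h : k ≤ n + 1) :
    numParticles X k (n + 1) = numParticles X k n + (X (n + 1)).toNat := by
  simp only [numParticles_eq_sum, sum_Icc_succ_right _ h]

lemma numParticles_pred_left (X : Config) {k n : ℤ} (h : k ≤ n + 1) :
    numParticles X (k - 1) n = (X (k - 1)).toNat + numParticles X k n := by
  have : Finset.Icc (k - 1) n = insert (k - 1) (Finset.Icc k n) := by
    ext x; simp only [Finset.mem_Icc, Finset.mem_insert]; omega
  rw [numParticles_eq_sum, numParticles_eq_sum, this, Finset.sum_insert (by simp)]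

lemma numParticles_of_lt (X : Config) {k n : ℤ} (h : n < k) : numParticles X k n = 0 := by
  simp [numParticles, Finset.Icc_eq_empty (not_le.2 h)]

lemma localVelocity_le_one (X : Config) (x : ℤ) : localVelocity X x ≤ 1 := by
  unfold localVelocity; split_ifs <;> simp

lemma toNat_step (X : Config) (x : ℤ) :
    (step X x).toNat + localVelocity X x = (X x).toNat + localVelocity X (x - 1) := by
  simp only [step, localVelocity, sub_add_cancel]
  cases X x <;> cases X (x - 1) <;> cases X (x + 1) <;> simp

/-- Conservation of particles in the window `{k, …, n}`; the window may be empty if `n = k - 1`. -/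
lemma numParticles_step (X : Config) {k n : ℤ} (h : k - 1 ≤ n) :
    numParticles (step X) k n + localVelocity X n =
      numParticles X k n + localVelocity X (k - 1) := by
  induction n, h using Int.leInduction with
  | base => simp [numParticles_of_lt]
  | succ n h ih =>
    have h1 := toNat_step X (n + 1)
    rw [add_sub_cancel_right] at h1
    rw [numParticles_succ_right _ (by omega), numParticles_succ_right _ (by omega)]
    omega

/-! ### Adjacent particles and adjacent holes at time `t` -/

/-- A pulled-back dense window: if a particle passes from `k - 1` to `k`, its old position is
included in the new window; otherwise the window only grows to the right. In both cases the excess of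
particles over holes does not decrease. -/
lemma exists_dense_window_step (X : Config) {k n : ℤ} (hkn : k ≤ n)
    (h0 : step X (n - 1) = true) (h1 : step X n = true)
    (h : n - k + 3 ≤ 2 * (numParticles (step X) k n : ℤ)) :
    X n = true ∧ X (n + 1) = true ∧ ∃ k' ≤ k,
      (n + 1) - k' + 3 ≤ 2 * (numParticles X k' (n + 1) : ℤ) := by
  have hX : X n = true ∧ X (n + 1) = true := by
    simp only [step, sub_add_cancel] at h0 h1
    revert h0 h1
    cases X n <;> cases X (n - 1) <;> cases X (n + 1) <;> simp
  refine ⟨hX.1, hX.2, ?_⟩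
  have hn : localVelocity X n = 0 := by simp [localVelocity, hX.2]
  have hc := numParticles_step X (show k - 1 ≤ n by omega)
  have hr := numParticles_succ_right X (show k ≤ n + 1 by omega)
  rw [hX.2, Bool.toNat_true] at hr
  by_cases hv : X (k - 1) = true ∧ X k = false
  · have hk : localVelocity X (k - 1) = 1 := by simp [localVelocity, hv]
    have hl := numParticles_pred_left X (show k ≤ n + 1 + 1 by omega)
    rw [hv.1, Bool.toNat_true] at hl
    exact ⟨k - 1, by omega, by omega⟩
  · have hk : localVelocity X (k - 1) = 0 := by
      rw [localVelocity, sub_add_cancel, if_neg hv]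
    exact ⟨k, le_rfl, by omega⟩

/-- Dual of `exists_dense_window_step`: a hole leaving the window at its right end, that is, a
particle passing from `n` to `n + 1`, is included in the new window. -/
lemma exists_sparse_window_step (X : Config) {k n : ℤ} (hkn : k ≤ n)
    (h0 : step X k = false) (h1 : step X (k + 1) = false)
    (h : 2 * (numParticles (step X) k n : ℤ) + 1 ≤ n - k) :
    X (k - 1) = false ∧ X k = false ∧ ∃ n' ≥ n,
      2 * (numParticles X (k - 1) n' : ℤ) + 1 ≤ n' - (k - 1) := by
  have hX : X (k - 1) = false ∧ X k = false := by
    simp only [step, add_sub_cancel_right] at h0 h1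
    revert h0 h1
    cases X k <;> cases X (k - 1) <;> cases X (k + 1) <;> simp
  refine ⟨hX.1, hX.2, ?_⟩
  have hk : localVelocity X (k - 1) = 0 := by simp [localVelocity, hX.1]
  have hc := numParticles_step X (show k - 1 ≤ n by omega)
  have hl := numParticles_pred_left X (show k ≤ n + 1 by omega)
  rw [hX.1, Bool.toNat_false] at hl
  by_cases hv : X n = true ∧ X (n + 1) = false
  · have hn : localVelocity X n = 1 := by simp [localVelocity, hv]
    have hr := numParticles_succ_right X (show k - 1 ≤ n + 1 by omega)
    rw [hv.2, Bool.toNat_false] at hr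
    exact ⟨n + 1, by omega, by omega⟩
  · have hn : localVelocity X n = 0 := by rw [localVelocity, if_neg hv]
    exact ⟨n, le_rfl, by omega⟩

lemma exists_dense_window_iterate (t : ℕ) (X : Config) {n : ℤ}
    (h0 : step^[t] X (n - 1) = true) (h1 : step^[t] X n = true) :
    X (n + t - 1) = true ∧ X (n + t) = true ∧ ∃ k ≤ n - 1,
      (n + t) - k + 3 ≤ 2 * (numParticles X k (n + t) : ℤ) := by
  induction t generalizing X with
  | zero =>
    simp only [Function.iterate_zero, id] at h0 h1
    have hr := numParticles_succ_right X (k := n - 1) (n := n - 1) (by omega)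
    have hl := numParticles_pred_left X (k := n) (n := n - 1) (by omega)
    rw [numParticles_of_lt X (show n - 1 < n by omega)] at hl
    rw [sub_add_cancel] at hr
    simp only [h0, h1, Bool.toNat_true] at hr hl
    refine ⟨by simpa using h0, by simpa using h1, n - 1, le_rfl, ?_⟩
    simp only [Nat.cast_zero, add_zero]
    omega
  | succ t ih =>
    rw [Function.iterate_succ_apply] at h0 h1
    obtain ⟨a, b, k, hk, h⟩ := ih (step X) h0 h1
    obtain ⟨a', b', k', hk', h'⟩ := exists_dense_window_step X (by omega) a b h
    have e : n + ((t + 1 : ℕ) : ℤ) = n + t + 1 := by push_cast; ring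
    rw [e, add_sub_cancel_right]
    exact ⟨a', b', k', hk'.trans hk, h'⟩

lemma exists_sparse_window_iterate (t : ℕ) (X : Config) {k : ℤ}
    (h0 : step^[t] X k = false) (h1 : step^[t] X (k + 1) = false) :
    X (k - t) = false ∧ X (k - t + 1) = false ∧ ∃ n ≥ k + 1,
      2 * (numParticles X (k - t) n : ℤ) + 1 ≤ n - (k - t) := by
  induction t generalizing X with
  | zero =>
    simp only [Function.iterate_zero, id] at h0 h1
    have hr := numParticles_succ_right X (k := k) (n := k) (by omega)
    have hr' := numParticles_succ_right X (k := k) (n := k - 1) (by omega)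
    rw [numParticles_of_lt X (show k - 1 < k by omega), sub_add_cancel] at hr'
    simp only [h0, h1, Bool.toNat_false] at hr hr'
    refine ⟨by simpa using h0, by simpa using h1, k + 1, le_rfl, ?_⟩
    simp only [Nat.cast_zero, sub_zero]
    omega
  | succ t ih =>
    rw [Function.iterate_succ_apply] at h0 h1
    obtain ⟨a, b, n, hn, h⟩ := ih (step X) h0 h1
    obtain ⟨a', b', n', hn', h'⟩ := exists_sparse_window_step X (by omega) a b h
    have e : k - ((t + 1 : ℕ) : ℤ) = k - t - 1 := by push_cast; ring
    rw [e, sub_add_cancel]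
    exact ⟨a', b', n', hn.le.trans hn', h'⟩

/-! ### Consequences of regularity -/

lemma IsRegular.exists_abs_sub_lt {X : Config} {ρ : ℝ} (hX : IsRegular X ρ) {ε : ℝ}
    (hε : 0 < ε) : ∃ N₀ : ℕ, ∀ N ≥ N₀, 1 ≤ N → ∀ k : ℤ,
      |(numParticles X k (k + N - 1) : ℝ) / (N : ℝ) - ρ| < ε := by
  obtain ⟨φ, -, hφ, h⟩ := hX
  obtain ⟨N₀, hN₀⟩ := eventually_atTop.1 (hφ.eventually_lt_const hε)
  refine ⟨N₀, fun N hN h1 k => ?_⟩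
  have := h (k - 1) N h1
  rw [sub_add_cancel, show k - 1 + (N : ℤ) = k + N - 1 by ring] at this
  exact this.trans_lt (hN₀ N hN)

lemma IsRegular.nonneg {X : Config} {ρ : ℝ} (hX : IsRegular X ρ) : 0 ≤ ρ := by
  by_contra! hρ
  obtain ⟨N₀, h⟩ := hX.exists_abs_sub_lt (neg_pos.2 hρ)
  have h1 := (abs_lt.1 (h (N₀ + 1) (by omega) (by omega) 0)).2
  have h2 : (0 : ℝ) ≤ (numParticles X 0 (0 + (N₀ + 1 : ℕ) - 1) : ℝ) / ((N₀ + 1 : ℕ) : ℝ) := by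
    positivity
  linarith

lemma IsRegular.eventually_no_adjacent_particles {X : Config} {ρ : ℝ} (hX : IsRegular X ρ)
    (hρ : ρ < 1 / 2) :
    ∃ t₀ : ℕ, ∀ t ≥ t₀, ∀ x, step^[t] X x = true → step^[t] X (x + 1) = false := by
  obtain ⟨t₀, ht₀⟩ := hX.exists_abs_sub_lt (sub_pos.2 hρ)
  refine ⟨t₀, fun t ht x h0 => ?_⟩
  by_contra h1
  rw [Bool.not_eq_false] at h1
  obtain ⟨-, -, k, hk, h⟩ :=
    exists_dense_window_iterate t X (n := x + 1) (by rwa [add_sub_cancel_right]) h1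
  obtain ⟨N, hN⟩ := Int.eq_ofNat_of_zero_le (show 0 ≤ x + 1 + t - k + 1 by omega)
  have h2 := (abs_lt.1 (ht₀ N (by omega) (by omega) k)).2
  rw [show k + (N : ℤ) - 1 = x + 1 + t by omega] at h2
  have h3 : (N : ℤ) ≤ 2 * (numParticles X k (x + 1 + t) : ℤ) := by omega
  have h4 : (N : ℝ) ≤ 2 * (numParticles X k (x + 1 + t) : ℝ) := by exact_mod_cast h3
  have hpos : (0 : ℝ) < N := by
    have : 0 < N := by omega
    exact_mod_cast this
  have h5 : (numParticles X k (x + 1 + t) : ℝ) / N < 1 / 2 := by linarith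
  rw [div_lt_iff₀ hpos] at h5
  linarith

lemma IsRegular.eventually_no_adjacent_holes {X : Config} {ρ : ℝ} (hX : IsRegular X ρ)
    (hρ : 1 / 2 < ρ) :
    ∃ t₀ : ℕ, ∀ t ≥ t₀, ∀ x, step^[t] X x = false → step^[t] X (x + 1) = true := by
  obtain ⟨t₀, ht₀⟩ := hX.exists_abs_sub_lt (sub_pos.2 hρ)
  refine ⟨t₀, fun t ht x h0 => ?_⟩
  by_contra h1
  rw [Bool.not_eq_true] at h1
  obtain ⟨-, -, n, hn, h⟩ := exists_sparse_window_iterate t X h0 h1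
  obtain ⟨N, hN⟩ := Int.eq_ofNat_of_zero_le (show 0 ≤ n - (x - t) + 1 by omega)
  have h2 := (abs_lt.1 (ht₀ N (by omega) (by omega) (x - t))).1
  rw [show x - t + (N : ℤ) - 1 = n by omega] at h2
  have h3 : 2 * (numParticles X (x - t) n : ℤ) ≤ N := by omega
  have h4 : 2 * (numParticles X (x - t) n : ℝ) ≤ N := by exact_mod_cast h3
  have hpos : (0 : ℝ) < N := by
    have : 0 < N := by omega
    exact_mod_cast this
  have h5 : 1 / 2 < (numParticles X (x - t) n : ℝ) / N := by linarith
  rw [lt_div_iff₀ hpos] at h5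
  linarith

/-! ### Density -/

/-- Two sequences that differ by at most one have the same limit after division by `2n`. -/
lemma tendsto_div_of_abs_sub_le_one {a b : ℕ → ℝ} {ρ : ℝ} (hab : ∀ n, |b n - a n| ≤ 1)
    (ha : Tendsto (fun n : ℕ => a n / (2 * n)) atTop (𝓝 ρ)) :
    Tendsto (fun n : ℕ => b n / (2 * n)) atTop (𝓝 ρ) := by
  have h0 : Tendsto (fun n : ℕ => (b n - a n) / (2 * n)) atTop (𝓝 0) := by
    refine squeeze_zero_norm (fun n => ?_) tendsto_one_div_atTop_nhds_zero_nat
    rw [Real.norm_eq_abs, abs_div, abs_of_nonneg (by positivity : (0 : ℝ) ≤ 2 * n)]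
    rcases n.eq_zero_or_pos with rfl | hn
    · simp
    · have : (0 : ℝ) < n := by exact_mod_cast hn
      exact div_le_div₀ zero_le_one (hab n) this (by linarith)
  have h1 := ha.add h0
  rw [add_zero] at h1
  exact h1.congr fun n => by ring

lemma IsRegular.tendsto_density {X : Config} {ρ : ℝ} (hX : IsRegular X ρ) :
    Tendsto (fun n : ℕ => (numParticles X (-n) (n - 1) : ℝ) / (2 * n)) atTop (𝓝 ρ) := by
  rw [Metric.tendsto_atTop]
  intro ε hε
  obtain ⟨N₀, h⟩ := hX.exists_abs_sub_lt hε
  refine ⟨N₀ + 1, fun n hn => ?_⟩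
  have h1 := h (2 * n) (by omega) (by omega) (-n)
  rw [show -(n : ℤ) + (2 * n : ℕ) - 1 = n - 1 by push_cast; ring] at h1
  rw [Real.dist_eq]
  push_cast at h1
  exact h1

lemma tendsto_density_step {X : Config} {ρ : ℝ}
    (hX : Tendsto (fun n : ℕ => (numParticles X (-n) (n - 1) : ℝ) / (2 * n)) atTop (𝓝 ρ)) :
    Tendsto (fun n : ℕ => (numParticles (step X) (-n) (n - 1) : ℝ) / (2 * n)) atTop (𝓝 ρ) := by
  refine tendsto_div_of_abs_sub_le_one (fun n => ?_) hX
  have h := numParticles_step X (k := -(n : ℤ)) (n := n - 1) (by omega)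
  have h1 := localVelocity_le_one X (n - 1)
  have h2 := localVelocity_le_one X (-n - 1)
  have h3 : |(numParticles (step X) (-n) (n - 1) : ℤ) - numParticles X (-n) (n - 1)| ≤ 1 := by
    rw [abs_le]; omega
  exact_mod_cast h3

lemma tendsto_density_iterate (t : ℕ) {X : Config} {ρ : ℝ}
    (hX : Tendsto (fun n : ℕ => (numParticles X (-n) (n - 1) : ℝ) / (2 * n)) atTop (𝓝 ρ)) :
    Tendsto (fun n : ℕ => (numParticles (step^[t] X) (-n) (n - 1) : ℝ) / (2 * n))
      atTop (𝓝 ρ) := by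
  induction t generalizing X with
  | zero => exact hX
  | succ t ih => exact ih (tendsto_density_step hX)

/-! ### Velocity -/

lemma exists_particle_iterate (t : ℕ) {X : Config} (h : ∃ x, X x = true) :
    ∃ x, step^[t] X x = true := by
  induction t generalizing X with
  | zero => exact h
  | succ t ih =>
    refine ih ?_
    obtain ⟨x, hx⟩ := h
    by_cases h1 : X (x + 1) = true
    · exact ⟨x, by simp [step, hx, h1]⟩
    · exact ⟨x + 1, by simp [step, hx, h1]⟩

lemma hasAverageVelocity_one {X : Config} (h : ∀ x, X x = true → X (x + 1) = false)
    (hne : ∃ x, X x = true) : HasAverageVelocity X 1 := by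
  obtain ⟨x, hx⟩ := hne
  refine tendsto_const_nhds.congr' ?_
  filter_upwards [eventually_gt_atTop x.natAbs] with n hn
  have hS : ∑ y ∈ Finset.Icc (-(n : ℤ)) (n - 1), localVelocity X y =
      numParticles X (-n) (n - 1) := by
    rw [numParticles_eq_sum]
    refine Finset.sum_congr rfl fun y _ => ?_
    by_cases hy : X y = true
    · simp [localVelocity, hy, h y hy]
    · simp [localVelocity, hy]
  have hM : numParticles X (-n) (n - 1) ≠ 0 :=
    Finset.card_ne_zero_of_mem (a := x)
      (Finset.mem_filter.2 ⟨Finset.mem_Icc.2 ⟨by omega, by omega⟩, hx⟩)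
  rw [subVelocity, hS, div_self (Nat.cast_ne_zero.2 hM)]

/-- Without adjacent holes, the free particles in a window are the left neighbours of the holes of
the window shifted by one. -/
lemma sum_localVelocity_add_numParticles {X : Config}
    (h : ∀ x, X x = false → X (x + 1) = true) {k n : ℤ} (hkn : k ≤ n) :
    ((∑ x ∈ Finset.Icc k (n - 1), localVelocity X x : ℕ) : ℤ) + numParticles X (k + 1) n =
      n - k := by
  induction n, hkn using Int.leInduction with
  | base => simp [numParticles_of_lt]
  | succ n hn ih =>
    have h1 := sum_Icc_succ_right (localVelocity X) (k := k) (n := n - 1) (by omega)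
    rw [sub_add_cancel] at h1
    rw [add_sub_cancel_right, h1, numParticles_succ_right _ (by omega)]
    have h2 : localVelocity X n + (X (n + 1)).toNat = 1 := by
      have := h n
      revert this
      unfold localVelocity
      cases X n <;> cases X (n + 1) <;> simp
    omega

lemma hasAverageVelocity_of_no_adjacent_holes {X : Config} {ρ : ℝ}
    (h : ∀ x, X x = false → X (x + 1) = true) (hρ : ρ ≠ 0)
    (hX : Tendsto (fun n : ℕ => (numParticles X (-n) (n - 1) : ℝ) / (2 * n)) atTop (𝓝 ρ)) :
    HasAverageVelocity X (1 / ρ - 1) := by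
  have hS : Tendsto (fun n : ℕ =>
      ((∑ x ∈ Finset.Icc (-(n : ℤ)) (n - 1), localVelocity X x : ℕ) : ℝ) / (2 * n))
      atTop (𝓝 (1 - ρ)) := by
    refine tendsto_div_of_abs_sub_le_one
      (a := fun n => 2 * n - (numParticles X (-n) (n - 1) : ℝ)) (fun n => ?_) ?_
    · have h1 := sum_localVelocity_add_numParticles h (k := -(n : ℤ)) (n := n) (by omega)
      have h2 := numParticles_succ_right X (k := -(n : ℤ)) (n := n - 1) (by omega)
      have h3 := numParticles_pred_left X (k := -(n : ℤ) + 1) (n := n) (by omega)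
      rw [sub_add_cancel] at h2
      rw [add_sub_cancel_right] at h3
      have h4 := Bool.toNat_le (X n)
      have h5 := Bool.toNat_le (X (-n))
      have h6 : |((∑ x ∈ Finset.Icc (-(n : ℤ)) (n - 1), localVelocity X x : ℕ) : ℤ) -
          (2 * n - numParticles X (-n) (n - 1))| ≤ 1 := by
        rw [abs_le]; omega
      exact_mod_cast h6
    · refine (hX.const_sub 1).congr' ?_
      filter_upwards [eventually_gt_atTop 0] with n hn
      have : (n : ℝ) ≠ 0 := by exact_mod_cast hn.ne'
      field_simp
  have h1 := hS.div hX hρ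
  rw [show (1 - ρ) / ρ = 1 / ρ - 1 by field_simp] at h1
  refine h1.congr' ?_
  filter_upwards [eventually_gt_atTop 0] with n hn
  have : (2 * n : ℝ) ≠ 0 := by
    have : (0 : ℝ) < n := by exact_mod_cast hn
    positivity
  exact div_div_div_cancel_right₀ this _ _

end SlowTraffic

theorem mainTheorem2 (X : SlowTraffic.Config) (ρ : ℝ)
    (hX : SlowTraffic.IsRegular X ρ) (hρ : ρ ≠ 1 / 2) (hne : ∃ x : ℤ, X x = true) :
    ∃ t₀ : ℕ, ∀ t : ℕ, t₀ ≤ t →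
      SlowTraffic.HasAverageVelocity (SlowTraffic.step^[t] X)
        (if ρ = 0 then 1 else min 1 (1 / ρ - 1)) := by
  have h0 := hX.nonneg
  rcases hρ.lt_or_gt with hlt | hgt
  · obtain ⟨t₀, ht₀⟩ := hX.eventually_no_adjacent_particles hlt
    refine ⟨t₀, fun t ht => ?_⟩
    have hv : (if ρ = 0 then 1 else min 1 (1 / ρ - 1)) = 1 := by
      split_ifs with h
      · rfl
      · have hpos : 0 < ρ := lt_of_le_of_ne h0 (Ne.symm h)
        have : 2 ≤ 1 / ρ := by rw [le_div_iff₀ hpos]; linarith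
        exact min_eq_left (by linarith)
    rw [hv]
    exact SlowTraffic.hasAverageVelocity_one (ht₀ t ht)
      (SlowTraffic.exists_particle_iterate t hne)
  · obtain ⟨t₀, ht₀⟩ := hX.eventually_no_adjacent_holes hgt
    refine ⟨t₀, fun t ht => ?_⟩
    have hpos : 0 < ρ := by linarith
    have : 1 / ρ ≤ 2 := by rw [div_le_iff₀ hpos]; linarith
    rw [if_neg hpos.ne', min_eq_right (by linarith)]
    exact SlowTraffic.hasAverageVelocity_of_no_adjacent_holes (ht₀ t ht) hpos.ne'
      (SlowTraffic.tendsto_density_iterate t hX.tendsto_density)
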